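/- Let $\mathbb N=\{0,1,2,\dots\}$, let $\omega$ be the space of all real sequences $x=(x_k)_{k\in\mathbb N}$, and let $p=(p_k)$ be a bounded sequence of strictly positive real numbers. Let $f_0=f_1=1$ and $f_n=f_{n-1}+f_{n-2}$ for $n\ge 2$. For $x\in\omega$ put $$(\widehat F x)_n=\frac{f_n}{f_{n+1}}x_n-\frac{f_{n+1}}{f_n}x_{n-1}\quad(n\in\mathbb N),\qquad x_{-1}:=0,$$ and define $$c_0(\widehat F,p)=\Big\{x\in\omega:\lim_{n\to\infty}|(\widehat Fx)_n|^{p_n}=0\Big\},\qquad c(\widehat F,p)=\Big\{x\in\omega:\exists\, l\in\mathbb R,\ \lim_{n\to\infty}|(\widehat Fx)_n-l|^{p_n}=0\Big\}.$$ For $X\subseteq\omega$, let $X^\alpha$, $X^\beta$, $X^\gamma$ be the sets of all $a\in\omega$ such that, for every $x\in X$, the series $\sum_k a_kx_k$ is respectively absolutely convergent, convergent, or has bounded partial sums. Let $\mathcal F$ be the collection of all finite subsets of $\mathbb N$ and, for $K\in\mathcal F$ and $n\in\mathbb N$, let $K^*_n=\{k\in K: 0\le k\le n\}$. Define the following sets,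 where $B$ ranges over the integers $B>1$: $$\widehat F_1(p)=\bigcup_{B>1}\Big\{a\in\omega:\sup_{K\in\mathcal F}\sum_{n=0}^\infty\Big|\sum_{k\in K^*_n}\frac{f_{n+1}^2}{f_kf_{k+1}}a_nB^{-1/p_k}\Big|<\infty\Big\},$$ $$\widehat F_2(p)=\Big\{a\in\omega:\sum_{n=0}^\infty\Big|\sum_{k=0}^n\frac{f_{n+1}^2}{f_kf_{k+1}}a_n\Big|<\infty\Big\},$$ $$\widehat F_3(p)=\bigcup_{B>1}\Big\{a\in\omega:\sup_{n\in\mathbb N}\sum_{k=0}^n\Big|\sum_{j=k}^n\frac{f_{j+1}^2}{f_kf_{k+1}}a_j\Big|B^{-1/p_k}<\infty\Big\},$$ $$\widehat F_4(p)=\Big\{a\in\omega:\ \text{the series }\sum_{j=k}^\infty\frac{f_{j+1}^2}{f_kf_{k+1}}a_j\text{ converges for every }k\in\mathbb N\Big\},$$ $$\widehat F_5(p)=\bigcup_{B>1}\Big\{a\in\omega:\exists(\alpha_k)\subset\mathbb R,\ \sup_{n\in\mathbb N}\sum_{k=0}^n\Big|\sum_{j=k}^n\frac{f_{j+1}^2}{f_kf_{k+1}}a_j-\alpha_k\Big|B^{-1/p_k}<\infty\Big\},$$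 $$\widehat F_6(p)=\Big\{a\in\omega:\exists\alpha\in\mathbb R,\ \lim_{n\to\infty}\Big|\sum_{k=0}^n\sum_{j=k}^n\frac{f_{j+1}^2}{f_kf_{k+1}}a_j-\alpha\Big|=0\Big\},$$ $$\widehat F_7(p)=\Big\{a\in\omega:\sup_{n\in\mathbb N}\Big|\sum_{k=0}^n\sum_{j=k}^n\frac{f_{j+1}^2}{f_kf_{k+1}}a_j\Big|<\infty\Big\}.$$ Then (i) $\{c_0(\widehat F,p)\}^\alpha=\widehat F_1(p)$; (ii) $\{c(\widehat F,p)\}^\alpha=\widehat F_1(p)\cap\widehat F_2(p)$; (iii) $\{c_0(\widehat F,p)\}^\beta=\widehat F_3(p)\cap\widehat F_4(p)\cap\widehat F_5(p)$; (iv) $\{c(\widehat F,p)\}^\beta=\{c_0(\widehat F,p)\}^\beta\cap\widehat F_6(p)$; (v) $\{c_0(\widehat F,p)\}^\gamma=\widehat F_3(p)$; (vi) $\{c(\widehat F,p)\}^\gamma=\widehat F_3(p)\cap\widehat F_7(p)$. -/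

import Mathlib

open Filter Topology

noncomputable section

namespace FibSeq

/-- Fibonacci numbers with `f 0 = f 1 = 1` and `f (n + 2) = f (n + 1) + f n`, as reals. -/
def f (n : ℕ) : ℝ := (Nat.fib (n + 1) : ℝ)

/-- Absolutely convergent series. -/
def ell1 : Set (ℕ → ℝ) := {x | Summable fun k => |x k|}

/-- Convergent series: the partial sums converge (conditionally). -/
def cs : Set (ℕ → ℝ) :=
  {x | ∃ s : ℝ, Tendsto (fun n => ∑ k ∈ Finset.range (n + 1), x k) atTop (𝓝 s)}

/-- Bounded series: the partial sums are bounded. -/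
def bs : Set (ℕ → ℝ) :=
  {x | BddAbove (Set.range fun n => |∑ k ∈ Finset.range (n + 1), x k|)}

/-- The multiplier set `S(X, Y)`: all `z` with `x z ∈ Y` for every `x ∈ X`. -/
def multiplier (X Y : Set (ℕ → ℝ)) : Set (ℕ → ℝ) :=
  {z | ∀ x ∈ X, (fun k => x k * z k) ∈ Y}

def alphaDual (X : Set (ℕ → ℝ)) : Set (ℕ → ℝ) := multiplier X ell1

def betaDual (X : Set (ℕ → ℝ)) : Set (ℕ → ℝ) := multiplier X cs

def gammaDual (X : Set (ℕ → ℝ)) : Set (ℕ → ℝ) := multiplier X bs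

/-- Maddox's space `c₀(p)`. -/
def c0 (p : ℕ → ℝ) : Set (ℕ → ℝ) :=
  {x | Tendsto (fun k => |x k| ^ p k) atTop (𝓝 0)}

/-- Maddox's space `c(p)`. -/
def c (p : ℕ → ℝ) : Set (ℕ → ℝ) :=
  {x | ∃ l : ℝ, Tendsto (fun k => |x k - l| ^ p k) atTop (𝓝 0)}

/-- The Fibonacci difference transform
`(F̂ x)_n = (f_n / f_{n+1}) x_n - (f_{n+1} / f_n) x_{n-1}`, where `x_{-1} = 0`. -/
def fHat (x : ℕ → ℝ) : ℕ → ℝ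
  | 0 => f 0 / f 1 * x 0
  | n + 1 => f (n + 1) / f (n + 2) * x (n + 1) - f (n + 2) / f (n + 1) * x n

/-- `c₀(F̂, p)`: the sequences whose `F̂`-transform lies in `c₀(p)`. -/
def c0F (p : ℕ → ℝ) : Set (ℕ → ℝ) := {x | fHat x ∈ c0 p}

/-- `c(F̂, p)`: the sequences whose `F̂`-transform lies in `c(p)`. -/
def cF (p : ℕ → ℝ) : Set (ℕ → ℝ) := {x | fHat x ∈ c p}

/-- The coefficient `f_{n+1}² / (f_k f_{k+1})`. -/
def coef (n k : ℕ) : ℝ := f (n + 1) ^ 2 / (f k * f (k + 1))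

/-- The supremum over finite `K` of the series of nonnegative terms is taken in `[0, ∞]`;
the inner sum runs over `K* = {0, …, n} ∩ K`. -/
def F1 (p : ℕ → ℝ) : Set (ℕ → ℝ) :=
  ⋃ (B : ℕ) (_ : 1 < B), {a |
    (⨆ K : Finset ℕ, ∑' n : ℕ, ENNReal.ofReal
      |∑ k ∈ Finset.range (n + 1) ∩ K, coef n k * a n * (B : ℝ) ^ (-1 / p k)|) < ⊤}

def F2 : Set (ℕ → ℝ) :=
  {a | Summable fun n => |∑ k ∈ Finset.range (n + 1), coef n k * a n|}

def F3 (p : ℕ → ℝ) : Set (ℕ → ℝ) :=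
  ⋃ (B : ℕ) (_ : 1 < B), {a |
    BddAbove (Set.range fun n : ℕ => ∑ k ∈ Finset.range (n + 1),
      |∑ j ∈ Finset.Icc k n, coef j k * a j| * (B : ℝ) ^ (-1 / p k))}

/-- For every `k`, the series `∑_{j ≥ k} f_{j+1}² / (f_k f_{k+1}) a_j` converges. -/
def F4 : Set (ℕ → ℝ) :=
  {a | ∀ k : ℕ, ∃ s : ℝ,
    Tendsto (fun n => ∑ j ∈ Finset.Icc k n, coef j k * a j) atTop (𝓝 s)}

def F5 (p : ℕ → ℝ) : Set (ℕ → ℝ) :=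
  ⋃ (B : ℕ) (_ : 1 < B), {a | ∃ α : ℕ → ℝ,
    BddAbove (Set.range fun n : ℕ => ∑ k ∈ Finset.range (n + 1),
      |(∑ j ∈ Finset.Icc k n, coef j k * a j) - α k| * (B : ℝ) ^ (-1 / p k))}

def F6 : Set (ℕ → ℝ) :=
  {a | ∃ α : ℝ, Tendsto (fun n => |(∑ k ∈ Finset.range (n + 1),
    ∑ j ∈ Finset.Icc k n, coef j k * a j) - α|) atTop (𝓝 0)}

def F7 : Set (ℕ → ℝ) :=
  {a | BddAbove (Set.range fun n : ℕ =>
    |∑ k ∈ Finset.range (n + 1), ∑ j ∈ Finset.Icc k n, coef j k * a j|)}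

end FibSeq

end

/-! The transform `fHat` is a bijection with triangular inverse `recover`, so `∑ a_k x_k` over `c0F
p` has partial sums equal to those of the triangular matrix `tri a` applied to `y = fHat x` in `c0
p`. Bounded partial sums for all `y` are equivalent to a weighted row bound: necessity is a gliding
hump (`exists_bddAbove_weighted_of_bddAbove`), sufficiency is domination of `y` by the weights.
Convergence needs in addition column limits (`exists_tendsto_of_weighted`). Since `coef` is
positive, the α-dual follows from the γ-dual applied to `|a|`. Passing to `cF p` adds one test
sequence, `recover 1`. -/

namespace FibSeq

/-! ### Inverting the Fibonacci difference transform. -/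

lemma f_pos (n : ℕ) : 0 < f n := by
  unfold f
  exact_mod_cast Nat.fib_pos.2 n.succ_pos

lemma coef_pos (n k : ℕ) : 0 < coef n k := by
  unfold coef
  have := f_pos (n + 1)
  have := f_pos k
  have := f_pos (k + 1)
  positivity

/-- The inverse of `fHat`. -/
noncomputable def recover (y : ℕ → ℝ) (n : ℕ) : ℝ := ∑ k ∈ Finset.range (n + 1), coef n k * y k

/-- With the square factored out, both terms of `fHat` carry the factor `f n * f (n + 1)`, and the
sums telescope. -/
lemma recover_eq (y : ℕ → ℝ) (n : ℕ) :
    recover y n = f (n + 1) ^ 2 * ∑ k ∈ Finset.range (n + 1), y k / (f k * f (k + 1)) := by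
  rw [recover, Finset.mul_sum]
  refine Finset.sum_congr rfl fun k _ => ?_
  rw [coef]
  ring

lemma fHat_recover (y : ℕ → ℝ) : fHat (recover y) = y := by
  funext n
  cases n with
  | zero =>
    have h0 := (f_pos 0).ne'
    have h1 := (f_pos 1).ne'
    simp only [fHat, recover_eq, zero_add, Finset.sum_range_one]
    field_simp
  | succ n =>
    have h1 := (f_pos (n + 1)).ne'
    have h2 := (f_pos (n + 2)).ne'
    simp only [fHat, recover_eq]
    rw [Finset.sum_range_succ _ (n + 1)]
    generalize ∑ k ∈ Finset.range (n + 1), y k / (f k * f (k + 1)) = s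
    field_simp
    ring

lemma fHat_injective : Function.Injective fHat := by
  intro x x' h
  funext n
  induction n with
  | zero =>
    have h0 := congrFun h 0
    simp only [fHat] at h0
    exact mul_left_cancel₀ (div_pos (f_pos 0) (f_pos 1)).ne' h0
  | succ n ih =>
    have h0 := congrFun h (n + 1)
    simp only [fHat, ih] at h0
    exact mul_left_cancel₀ (div_pos (f_pos (n + 1)) (f_pos (n + 2))).ne' (by linarith)

lemma recover_fHat (x : ℕ → ℝ) : recover (fHat x) = x :=
  fHat_injective (fHat_recover _)

lemma recover_add_const (y : ℕ → ℝ) (l : ℝ) (n : ℕ) :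
    recover (fun k => y k + l) n = recover y n + l * recover (fun _ => 1) n := by
  simp only [recover, mul_add, Finset.sum_add_distrib, Finset.mul_sum]
  congr 1
  exact Finset.sum_congr rfl fun k _ => by ring

/-- The triangular matrix whose transforms of `fHat x` are the partial sums of `∑ a_k x_k`. -/
noncomputable def tri (a : ℕ → ℝ) (m k : ℕ) : ℝ := ∑ j ∈ Finset.Icc k m, coef j k * a j

lemma sum_recover_mul (a y : ℕ → ℝ) (m : ℕ) :
    ∑ n ∈ Finset.range (m + 1), recover y n * a n
      = ∑ k ∈ Finset.range (m + 1), tri a m k * y k := by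
  simp only [recover, tri, Finset.sum_mul]
  rw [Finset.sum_comm' (t' := Finset.range (m + 1)) (s' := fun k => Finset.Icc k m)]
  · exact Finset.sum_congr rfl fun k _ => Finset.sum_congr rfl fun j _ => by ring
  · intro n k
    simp only [Finset.mem_range, Finset.mem_Icc]
    omega

lemma mem_multiplier_c0F {p z : ℕ → ℝ} {Y : Set (ℕ → ℝ)} :
    z ∈ multiplier (c0F p) Y ↔ ∀ y ∈ c0 p, (fun k => recover y k * z k) ∈ Y := by
  constructor
  · intro h y hy
    exact h _ (by simpa only [c0F, Set.mem_ofPred_eq, fHat_recover] using hy)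
  · intro h x hx
    simpa only [recover_fHat] using h _ hx

/-- Subtracting the limit `l` from `fHat x` splits `x` into an element of `c0F p` plus `l` times
`recover 1`. -/
lemma mem_multiplier_cF {p z : ℕ → ℝ} (hp : ∀ k, 0 < p k) {Y : Set (ℕ → ℝ)}
    (hY : ∀ u ∈ Y, ∀ v ∈ Y, ∀ l : ℝ, (fun k => u k + l * v k) ∈ Y) :
    z ∈ multiplier (cF p) Y ↔
      z ∈ multiplier (c0F p) Y ∧ (fun k => recover (fun _ => 1) k * z k) ∈ Y := by
  constructor
  · intro h
    refine ⟨fun x hx => h x ⟨0, by simpa [c0F, c0] using hx⟩, h _ ?_⟩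
    simp only [cF, Set.mem_ofPred_eq, fHat_recover]
    exact ⟨1, by simp [Real.zero_rpow (hp _).ne']⟩
  · rintro ⟨h0, h1⟩ x ⟨l, hl⟩
    have hu := hY _ (mem_multiplier_c0F.1 h0 (fun k => fHat x k - l) hl) _ h1 l
    convert hu using 2 with k
    have := recover_add_const (fun k => fHat x k - l) l k
    simp only [sub_add_cancel] at this
    change recover (fHat x) k = _ at this
    rw [recover_fHat] at this
    rw [this]
    ring

/-! ### Triangular matrices on Maddox's space `c0 p`. -/

section Weights

variable {p : ℕ → ℝ}

lemma weight_pos {B : ℕ} (hB : 1 < B) (k : ℕ) : 0 < (B : ℝ) ^ (-1 / p k) :=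
  Real.rpow_pos_of_pos (by exact_mod_cast zero_lt_one.trans hB) _

lemma weight_le_one (hp : ∀ k, 0 < p k) {B : ℕ} (hB : 1 < B) (k : ℕ) :
    (B : ℝ) ^ (-1 / p k) ≤ 1 :=
  Real.rpow_le_one_of_one_le_of_nonpos (by exact_mod_cast hB.le)
    (div_nonpos_of_nonpos_of_nonneg (by norm_num) (hp k).le)

lemma weight_rpow (hp : ∀ k, 0 < p k) (B k : ℕ) :
    ((B : ℝ) ^ (-1 / p k)) ^ p k = (B : ℝ)⁻¹ := by
  rw [← Real.rpow_mul (Nat.cast_nonneg B), div_mul_cancel₀ _ (hp k).ne', Real.rpow_neg_one]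

lemma eventually_abs_le_weight (hp : ∀ k, 0 < p k) (hb : BddAbove (Set.range p))
    {y : ℕ → ℝ} (hy : y ∈ c0 p) {B : ℕ} (hB : 1 < B) {ε : ℝ} (hε : 0 < ε) :
    ∀ᶠ k in atTop, |y k| ≤ ε * (B : ℝ) ^ (-1 / p k) := by
  obtain ⟨H, hH⟩ := hb
  have hB0 : (0 : ℝ) < B := by exact_mod_cast zero_lt_one.trans hB
  -- A base at most 1 has `p k`-th power at least its `H`-th power, a positive bound independent of
  -- `k`.
  have hδ : 0 < min ε 1 := lt_min hε one_pos
  have hη : 0 < (min ε 1) ^ H * (B : ℝ)⁻¹ := by positivity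
  filter_upwards [hy.eventually (Iio_mem_nhds hη)] with k hk
  have hw := weight_pos (p := p) hB k
  have h1 : |y k| ^ p k ≤ (min ε 1 * (B : ℝ) ^ (-1 / p k)) ^ p k := by
    rw [Real.mul_rpow hδ.le hw.le, weight_rpow hp]
    refine (le_of_lt hk).trans (mul_le_mul_of_nonneg_right ?_ (by positivity))
    exact Real.rpow_le_rpow_of_exponent_ge hδ (min_le_right _ _) (hH ⟨k, rfl⟩)
  have h2 := (Real.rpow_le_rpow_iff (abs_nonneg _) (by positivity) (hp k)).1 h1
  exact h2.trans (mul_le_mul_of_nonneg_right (min_le_left _ _) hw.le)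

lemma exists_abs_le_weight (hp : ∀ k, 0 < p k) (hb : BddAbove (Set.range p))
    {y : ℕ → ℝ} (hy : y ∈ c0 p) {B : ℕ} (hB : 1 < B) :
    ∃ M, 0 ≤ M ∧ ∀ k, |y k| ≤ M * (B : ℝ) ^ (-1 / p k) := by
  obtain ⟨N, hN⟩ := eventually_atTop.1 (eventually_abs_le_weight hp hb hy hB one_pos)
  have hs : ∀ k, 0 ≤ |y k| / (B : ℝ) ^ (-1 / p k) :=
    fun k => div_nonneg (abs_nonneg _) (weight_pos hB k).le
  have hS := Finset.sum_nonneg fun k (_ : k ∈ Finset.range N) => hs k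
  refine ⟨1 + ∑ k ∈ Finset.range N, |y k| / (B : ℝ) ^ (-1 / p k), by linarith, fun k => ?_⟩
  have hw := weight_pos (p := p) hB k
  rcases lt_or_ge k N with hk | hk
  · rw [← div_le_iff₀ hw]
    have := Finset.single_le_sum (fun k _ => hs k) (Finset.mem_range.2 hk)
    linarith
  · exact (hN k hk).trans (mul_le_mul_of_nonneg_right (by linarith) hw.le)

lemma single_mem_c0 (hp : ∀ k, 0 < p k) (i : ℕ) : (Pi.single i 1 : ℕ → ℝ) ∈ c0 p := by
  refine tendsto_const_nhds.congr' ?_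
  filter_upwards [eventually_gt_atTop i] with k hk
  rw [Pi.single_eq_of_ne hk.ne', abs_zero, Real.zero_rpow (hp k).ne']

/-- Uniform boundedness principle for triangular matrices on `c₀(p)`. -/
lemma exists_bddAbove_weighted_of_bddAbove (hp : ∀ k, 0 < p k) {E : ℕ → ℕ → ℝ}
    (h : ∀ y ∈ c0 p, BddAbove (Set.range fun m =>
      |∑ k ∈ Finset.range (m + 1), E m k * y k|)) :
    ∃ B : ℕ, 1 < B ∧ BddAbove (Set.range fun m =>
      ∑ k ∈ Finset.range (m + 1), |E m k| * (B : ℝ) ^ (-1 / p k)) := by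
  by_contra! hcon
  have hcol : ∀ k, ∃ C, ∀ m, k ≤ m → |E m k| ≤ C := by
    intro k
    obtain ⟨C, hC⟩ := h _ (single_mem_c0 hp k)
    refine ⟨C, fun m hm => ?_⟩
    have := hC ⟨m, rfl⟩
    simpa [Pi.single_apply, Nat.lt_succ_of_le hm] using this
  choose C hC using hcol
  have hC0 : ∀ k, 0 ≤ C k := fun k => (abs_nonneg _).trans (hC k k le_rfl)
  -- The head is paid for twice: once when removed from the weighted sum, once when removed from the
  -- sum against `y`.
  have hbig : ∀ b N : ℕ, ∃ m, (b : ℝ) + 2 * ∑ k ∈ Finset.range N, C k <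
      ∑ k ∈ Finset.range (m + 1), |E m k| * ((b + 2 : ℕ) : ℝ) ^ (-1 / p k) := by
    intro b N
    by_contra! hle
    exact hcon (b + 2) (by omega) ⟨_, by rintro _ ⟨m, rfl⟩; exact hle m⟩
  choose μ hμ using hbig
  have hterm : ∀ b m k : ℕ, k ≤ m → |E m k| * ((b + 2 : ℕ) : ℝ) ^ (-1 / p k) ≤ C k := by
    intro b m k hk
    calc _ ≤ |E m k| * 1 := mul_le_mul_of_nonneg_left
            (weight_le_one hp (by omega) k) (abs_nonneg _)
      _ ≤ C k := by rw [mul_one]; exact hC k m hk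
  have hNμ : ∀ b N, N ≤ μ b N := by
    intro b N
    by_contra! hlt
    have h1 := hμ b N
    have h2 : ∑ k ∈ Finset.range (μ b N + 1),
        |E (μ b N) k| * ((b + 2 : ℕ) : ℝ) ^ (-1 / p k) ≤ ∑ k ∈ Finset.range N, C k :=
      (Finset.sum_le_sum fun k hk => hterm b _ k
        (Nat.lt_succ_iff.1 (Finset.mem_range.1 hk))).trans
        (Finset.sum_le_sum_of_subset_of_nonneg
          (Finset.range_subset_range.2 hlt) fun k _ _ => hC0 k)
    have h3 := Finset.sum_nonneg fun k (_ : k ∈ Finset.range N) => hC0 k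
    have h4 : (0 : ℝ) ≤ b := Nat.cast_nonneg b
    linarith
  -- Block `b` is `[N b, N (b + 1))`, ending at the diagonal of the row chosen for `b`.
  obtain ⟨N, hNsucc⟩ : ∃ N : ℕ → ℕ, ∀ b, N (b + 1) = μ b (N b) + 1 :=
    ⟨fun b => Nat.rec (motive := fun _ => ℕ) 0 (fun b n => μ b n + 1) b, fun _ => rfl⟩
  have hNmono : StrictMono N := strictMono_nat_of_lt_succ fun b => by
    rw [hNsucc]
    exact Nat.lt_succ_of_le (hNμ b _)
  -- The block containing `k`; the search bound `k` loses nothing because `b ≤ N b`.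
  let β : ℕ → ℕ := fun k => Nat.findGreatest (fun b => N b ≤ k) k
  have hβ : ∀ b k, N b ≤ k → k < N (b + 1) → β k = b := by
    intro b k h1 h2
    have h0 : b ≤ β k := Nat.le_findGreatest ((hNmono.id_le b).trans h1) h1
    refine le_antisymm ?_ h0
    have h3 : N (β k) ≤ k :=
      Nat.findGreatest_spec (P := fun b => N b ≤ k) ((hNmono.id_le b).trans h1) h1
    exact Nat.lt_succ_iff.1 (hNmono.lt_iff_lt.1 (h3.trans_lt h2))
  have hβtop : Tendsto β atTop atTop := by
    refine tendsto_atTop.2 fun b => ?_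
    filter_upwards [eventually_ge_atTop (N b)] with k hk
    exact Nat.le_findGreatest ((hNmono.id_le b).trans hk) hk
  -- On block `b` the signs match the chosen row, and `|y k| ^ p k ≤ 1 / (b + 2)` puts `y` in `c0
  -- p`.
  let y : ℕ → ℝ := fun k =>
    SignType.sign (E (μ (β k) (N (β k))) k) * ((β k + 2 : ℕ) : ℝ) ^ (-1 / p k)
  have hyabs : ∀ k, |y k| ≤ ((β k + 2 : ℕ) : ℝ) ^ (-1 / p k) := by
    intro k
    have hw := weight_pos (p := p) (B := β k + 2) (by omega) k
    simp only [y]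
    rw [abs_mul, abs_of_pos hw]
    refine mul_le_of_le_one_left hw.le ?_
    rcases lt_trichotomy (E (μ (β k) (N (β k))) k) 0 with h | h | h <;> simp [h]
  have hy : y ∈ c0 p := by
    refine squeeze_zero (g := fun k => ((β k + 2 : ℕ) : ℝ)⁻¹)
      (fun k => Real.rpow_nonneg (abs_nonneg _) _) (fun k => ?_) ?_
    · rw [← weight_rpow hp]
      exact Real.rpow_le_rpow (abs_nonneg _) (hyabs k) (hp k).le
    · exact tendsto_inv_atTop_zero.comp (tendsto_natCast_atTop_atTop.comp
        ((tendsto_add_atTop_nat 2).comp hβtop))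
  obtain ⟨M, hM⟩ := h y hy
  obtain ⟨b, hb⟩ := exists_nat_gt M
  have h1 := hμ b (N b)
  have h2 := hM ⟨μ b (N b), rfl⟩
  have hle : N b ≤ μ b (N b) + 1 := (hNμ b _).trans (Nat.le_succ _)
  simp only at h2
  rw [← Finset.sum_range_add_sum_Ico _ hle] at h1 h2
  have h3 : ∑ k ∈ Finset.Ico (N b) (μ b (N b) + 1), E (μ b (N b)) k * y k
      = ∑ k ∈ Finset.Ico (N b) (μ b (N b) + 1),
        |E (μ b (N b)) k| * ((b + 2 : ℕ) : ℝ) ^ (-1 / p k) := by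
    refine Finset.sum_congr rfl fun k hk => ?_
    rw [Finset.mem_Ico] at hk
    simp only [y, hβ b k hk.1 (hk.2.trans_eq (hNsucc b).symm)]
    rw [← mul_assoc, self_mul_sign]
  have h4 : ∑ k ∈ Finset.range (N b), |E (μ b (N b)) k| * ((b + 2 : ℕ) : ℝ) ^ (-1 / p k)
      ≤ ∑ k ∈ Finset.range (N b), C k :=
    Finset.sum_le_sum fun k hk => hterm b _ k
      ((Finset.mem_range.1 hk).le.trans (hNμ b _))
  have h5 : |∑ k ∈ Finset.range (N b), E (μ b (N b)) k * y k|
      ≤ ∑ k ∈ Finset.range (N b), C k := by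
    refine (Finset.abs_sum_le_sum_abs _ _).trans (Finset.sum_le_sum fun k hk => ?_)
    rw [abs_mul]
    exact (mul_le_mul_of_nonneg_left (hyabs k) (abs_nonneg _)).trans
      (hterm _ _ k ((Finset.mem_range.1 hk).le.trans (hNμ b _)))
  rw [h3] at h2
  have h6 := neg_abs_le (∑ k ∈ Finset.range (N b), E (μ b (N b)) k * y k)
  have h7 := (le_abs_self _).trans h2
  linarith

lemma bddAbove_of_weighted (hp : ∀ k, 0 < p k) (hb : BddAbove (Set.range p))
    {E : ℕ → ℕ → ℝ} {B : ℕ} (hB : 1 < B) (hE : BddAbove (Set.range fun m =>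
      ∑ k ∈ Finset.range (m + 1), |E m k| * (B : ℝ) ^ (-1 / p k)))
    {y : ℕ → ℝ} (hy : y ∈ c0 p) :
    BddAbove (Set.range fun m => |∑ k ∈ Finset.range (m + 1), E m k * y k|) := by
  obtain ⟨S, hS⟩ := hE
  obtain ⟨M, hM0, hM⟩ := exists_abs_le_weight hp hb hy hB
  refine ⟨M * S, ?_⟩
  rintro _ ⟨m, rfl⟩
  refine (Finset.abs_sum_le_sum_abs _ _).trans
    (le_trans ?_ (mul_le_mul_of_nonneg_left (hS ⟨m, rfl⟩) hM0))
  simp only [Finset.mul_sum]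
  refine Finset.sum_le_sum fun k _ => ?_
  rw [abs_mul]
  exact (mul_le_mul_of_nonneg_left (hM k) (abs_nonneg _)).trans_eq (by ring)

/-- A fixed finite head converges column by column; the tail is small uniformly in the row, being at
most `δ * S`. -/
lemma exists_tendsto_of_weighted (hp : ∀ k, 0 < p k) (hb : BddAbove (Set.range p))
    {E : ℕ → ℕ → ℝ} {B : ℕ} (hB : 1 < B) (hE : BddAbove (Set.range fun m =>
      ∑ k ∈ Finset.range (m + 1), |E m k| * (B : ℝ) ^ (-1 / p k)))
    (hcol : ∀ k, ∃ s, Tendsto (fun m => E m k) atTop (𝓝 s))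
    {y : ℕ → ℝ} (hy : y ∈ c0 p) :
    ∃ s, Tendsto (fun m => ∑ k ∈ Finset.range (m + 1), E m k * y k) atTop (𝓝 s) := by
  obtain ⟨S, hS⟩ := hE
  have hS0 : 0 ≤ S := (Finset.sum_nonneg fun k _ =>
    mul_nonneg (abs_nonneg _) (weight_pos hB k).le).trans (hS ⟨0, rfl⟩)
  choose α hα using hcol
  refine cauchySeq_tendsto_of_complete (Metric.cauchySeq_iff.2 fun ε hε => ?_)
  set δ := ε / (3 * (S + 1)) with hδ
  have hδ0 : 0 < δ := by positivity
  have hδS : δ * S < ε / 3 := by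
    rw [hδ, div_mul_eq_mul_div, div_lt_div_iff₀ (by positivity) (by norm_num)]
    nlinarith
  obtain ⟨N, hN⟩ := eventually_atTop.1 (eventually_abs_le_weight hp hb hy hB hδ0)
  have hhead : CauchySeq fun m => ∑ k ∈ Finset.range N, E m k * y k :=
    (tendsto_finsetSum (Finset.range N) fun k _ => (hα k).mul_const (y k)).cauchySeq
  obtain ⟨N', hN'⟩ := Metric.cauchySeq_iff.1 hhead (ε / 3) (by positivity)
  have htail : ∀ m, N ≤ m → |∑ k ∈ Finset.Ico N (m + 1), E m k * y k| < ε / 3 := by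
    intro m _
    refine lt_of_le_of_lt ?_ hδS
    refine (Finset.abs_sum_le_sum_abs _ _).trans
      (le_trans ?_ (mul_le_mul_of_nonneg_left (hS ⟨m, rfl⟩) hδ0.le))
    simp only [Finset.mul_sum]
    calc ∑ k ∈ Finset.Ico N (m + 1), |E m k * y k|
        ≤ ∑ k ∈ Finset.Ico N (m + 1), δ * (|E m k| * (B : ℝ) ^ (-1 / p k)) := by
          refine Finset.sum_le_sum fun k hk => ?_
          rw [abs_mul]
          exact (mul_le_mul_of_nonneg_left (hN k (Finset.mem_Ico.1 hk).1)
            (abs_nonneg _)).trans_eq (by ring)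
      _ ≤ _ := by
          refine Finset.sum_le_sum_of_subset_of_nonneg (fun k hk => ?_) fun k _ _ =>
            mul_nonneg hδ0.le (mul_nonneg (abs_nonneg _) (weight_pos hB k).le)
          exact Finset.mem_range.2 (Finset.mem_Ico.1 hk).2
  refine ⟨max N N', fun m hm n hn => ?_⟩
  have hmN := (le_max_left N N').trans hm
  have hnN := (le_max_left N N').trans hn
  have h0 := hN' m ((le_max_right N N').trans hm) n ((le_max_right N N').trans hn)
  have h1 := abs_lt.1 (htail m hmN)
  have h2 := abs_lt.1 (htail n hnN)
  rw [Real.dist_eq, abs_lt] at h0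
  rw [Real.dist_eq, ← Finset.sum_range_add_sum_Ico _ (hmN.trans (Nat.le_succ m)),
    ← Finset.sum_range_add_sum_Ico _ (hnN.trans (Nat.le_succ n)), abs_lt]
  constructor <;> linarith [h0.1, h0.2, h1.1, h1.2, h2.1, h2.2]

end Weights

/-! ### Computation of the duals. -/

lemma ell1_add_mul {u v : ℕ → ℝ} (hu : u ∈ ell1) (hv : v ∈ ell1) (l : ℝ) :
    (fun k => u k + l * v k) ∈ ell1 :=
  (summable_abs_iff.1 hu |>.add ((summable_abs_iff.1 hv).mul_left l)).abs

lemma cs_add_mul {u v : ℕ → ℝ} (hu : u ∈ cs) (hv : v ∈ cs) (l : ℝ) :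
    (fun k => u k + l * v k) ∈ cs := by
  obtain ⟨s, hs⟩ := hu
  obtain ⟨t, ht⟩ := hv
  refine ⟨s + l * t, ?_⟩
  simpa only [Finset.sum_add_distrib, ← Finset.mul_sum] using hs.add (ht.const_mul l)

lemma bs_add_mul {u v : ℕ → ℝ} (hu : u ∈ bs) (hv : v ∈ bs) (l : ℝ) :
    (fun k => u k + l * v k) ∈ bs := by
  obtain ⟨s, hs⟩ := hu
  obtain ⟨t, ht⟩ := hv
  refine ⟨s + |l| * t, ?_⟩
  rintro _ ⟨n, rfl⟩
  simp only [Finset.sum_add_distrib, ← Finset.mul_sum]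
  refine (abs_add_le _ _).trans (add_le_add (hs ⟨n, rfl⟩) ?_)
  rw [abs_mul]
  exact mul_le_mul_of_nonneg_left (ht ⟨n, rfl⟩) (abs_nonneg l)

lemma cs_subset_bs : cs ⊆ bs := by
  rintro x ⟨s, hs⟩
  exact hs.abs.bddAbove_range

lemma mem_F3 {p a : ℕ → ℝ} : a ∈ F3 p ↔ ∃ B : ℕ, 1 < B ∧ BddAbove (Set.range fun m =>
    ∑ k ∈ Finset.range (m + 1), |tri a m k| * (B : ℝ) ^ (-1 / p k)) := by
  simp only [F3, Set.mem_iUnion, Set.mem_ofPred_eq, tri, exists_prop]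

theorem gammaDual_c0F {p : ℕ → ℝ} (hp : ∀ k, 0 < p k) (hb : BddAbove (Set.range p)) :
    gammaDual (c0F p) = F3 p := by
  ext a
  rw [gammaDual, mem_multiplier_c0F, mem_F3]
  simp only [bs, Set.mem_ofPred_eq, sum_recover_mul]
  exact ⟨exists_bddAbove_weighted_of_bddAbove hp,
    fun ⟨B, hB, h⟩ y hy => bddAbove_of_weighted hp hb hB h hy⟩

theorem betaDual_c0F {p : ℕ → ℝ} (hp : ∀ k, 0 < p k) (hb : BddAbove (Set.range p)) :
    betaDual (c0F p) = F3 p ∩ F4 ∩ F5 p := by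
  ext a
  constructor
  · intro h
    have h3 : a ∈ F3 p := by
      rw [← gammaDual_c0F hp hb]
      exact fun x hx => cs_subset_bs (h x hx)
    refine ⟨⟨h3, fun i => ?_⟩, ?_⟩
    · obtain ⟨s, hs⟩ := mem_multiplier_c0F.1 h _ (single_mem_c0 hp i)
      refine ⟨s, hs.congr' ?_⟩
      filter_upwards [eventually_ge_atTop i] with m hm
      rw [sum_recover_mul]
      simp [Pi.single_apply, Nat.lt_succ_of_le hm, tri]
    · simp only [F3, F5, Set.mem_iUnion, Set.mem_ofPred_eq] at h3 ⊢
      obtain ⟨B, hB, h3⟩ := h3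
      -- Taking `α = 0` shows that `F5 p` contains `F3 p`.
      exact ⟨B, hB, 0, by simpa using h3⟩
  · rintro ⟨⟨h3, h4⟩, -⟩
    obtain ⟨B, hB, h3⟩ := mem_F3.1 h3
    refine mem_multiplier_c0F.2 fun y hy => ?_
    simp only [cs, Set.mem_ofPred_eq, sum_recover_mul]
    exact exists_tendsto_of_weighted hp hb hB h3 h4 hy

/-- The row sums `∑_{k ≤ n} |coef n k a_n| B^{-1/p_k}`, summed over `n ≤ m`. -/
lemma sum_abs_mul_recover_weight (p a : ℕ → ℝ) (B m : ℕ) :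
    ∑ n ∈ Finset.range (m + 1), recover (fun k => (B : ℝ) ^ (-1 / p k)) n * |a n|
      = ∑ k ∈ Finset.range (m + 1), |tri (fun j => |a j|) m k| * (B : ℝ) ^ (-1 / p k) := by
  rw [sum_recover_mul]
  refine Finset.sum_congr rfl fun k _ => ?_
  rw [abs_of_nonneg]
  exact Finset.sum_nonneg fun j _ => mul_nonneg (coef_pos j k).le (abs_nonneg _)

lemma abs_recover_le {y v : ℕ → ℝ} {M : ℝ} (h : ∀ k, |y k| ≤ M * v k) (n : ℕ) :
    |recover y n| ≤ M * recover v n := by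
  rw [recover, recover, Finset.mul_sum]
  refine (Finset.abs_sum_le_sum_abs _ _).trans (Finset.sum_le_sum fun k _ => ?_)
  rw [abs_mul, abs_of_pos (coef_pos n k)]
  exact (mul_le_mul_of_nonneg_left (h k) (coef_pos n k).le).trans_eq (by ring)

lemma recover_weight_nonneg (p : ℕ → ℝ) {B : ℕ} (hB : 1 < B) (n : ℕ) :
    0 ≤ recover (fun k => (B : ℝ) ^ (-1 / p k)) n :=
  Finset.sum_nonneg fun k _ => mul_nonneg (coef_pos n k).le (weight_pos hB k).le

/-- By positivity of `coef` the inner sums increase with `K`, and `K = range N` already captures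
every row `n < N` in full. -/
lemma mem_F1 {p a : ℕ → ℝ} : a ∈ F1 p ↔ ∃ B : ℕ, 1 < B ∧
    Summable fun n => recover (fun k => (B : ℝ) ^ (-1 / p k)) n * |a n| := by
  simp only [F1, Set.mem_iUnion, Set.mem_ofPred_eq, exists_prop]
  refine exists_congr fun B => and_congr_right fun hB => ?_
  have hnn : ∀ n, 0 ≤ recover (fun k => (B : ℝ) ^ (-1 / p k)) n * |a n| :=
    fun n => mul_nonneg (recover_weight_nonneg p hB n) (abs_nonneg _)
  have habs : ∀ n (K : Finset ℕ),
      |∑ k ∈ Finset.range (n + 1) ∩ K, coef n k * a n * (B : ℝ) ^ (-1 / p k)|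
        = (∑ k ∈ Finset.range (n + 1) ∩ K, coef n k * (B : ℝ) ^ (-1 / p k)) * |a n| := by
    intro n K
    rw [← abs_of_nonneg (Finset.sum_nonneg fun k (_ : k ∈ Finset.range (n + 1) ∩ K) =>
      mul_nonneg (coef_pos n k).le (weight_pos (p := p) hB k).le), ← abs_mul, Finset.sum_mul]
    exact congrArg _ (Finset.sum_congr rfl fun k _ => by ring)
  constructor
  · intro h
    refine summable_of_sum_range_le (c := ENNReal.toReal (⨆ K : Finset ℕ, ∑' n : ℕ,
      ENNReal.ofReal |∑ k ∈ Finset.range (n + 1) ∩ K,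
        coef n k * a n * (B : ℝ) ^ (-1 / p k)|)) hnn fun N => ?_
    rw [← ENNReal.ofReal_le_iff_le_toReal h.ne, ENNReal.ofReal_sum_of_nonneg fun n _ => hnn n]
    refine le_trans ?_ (le_iSup _ (Finset.range N))
    refine le_trans ?_ (ENNReal.sum_le_tsum (Finset.range N))
    refine Finset.sum_le_sum fun n hn => ?_
    have hsub : Finset.range (n + 1) ∩ Finset.range N = Finset.range (n + 1) :=
      Finset.inter_eq_left.2 (Finset.range_subset_range.2 (Finset.mem_range.1 hn))
    rw [habs, hsub, recover]
  · intro h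
    refine lt_of_le_of_lt (iSup_le fun K => ENNReal.tsum_le_tsum fun n => ?_)
      (lt_top_iff_ne_top.2 h.tsum_ofReal_ne_top)
    rw [habs, recover]
    refine ENNReal.ofReal_le_ofReal (mul_le_mul_of_nonneg_right ?_ (abs_nonneg _))
    exact Finset.sum_le_sum_of_subset_of_nonneg Finset.inter_subset_left
      fun k _ _ => mul_nonneg (coef_pos n k).le (weight_pos hB k).le

theorem alphaDual_c0F {p : ℕ → ℝ} (hp : ∀ k, 0 < p k) (hb : BddAbove (Set.range p)) :
    alphaDual (c0F p) = F1 p := by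
  ext a
  rw [mem_F1]
  constructor
  · intro h
    -- Absolute convergence ignores signs, so `|a|` lies in the γ-dual; `tri |a|` is nonnegative,
    -- and exchanging sums turns its row bound into summability.
    have hγ : (fun n => |a n|) ∈ F3 p := by
      rw [← gammaDual_c0F hp hb]
      intro x hx
      refine ⟨∑' k, |x k * a k|, ?_⟩
      rintro _ ⟨n, rfl⟩
      refine (Finset.abs_sum_le_sum_abs _ _).trans ?_
      simp only [abs_mul, abs_abs]
      have hs : Summable fun k => |x k * a k| := h x hx
      simp only [abs_mul] at hs
      exact hs.sum_le_tsum _ fun k _ => by positivity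
    obtain ⟨B, hB, S, hS⟩ := mem_F3.1 hγ
    have hnn : ∀ n, 0 ≤ recover (fun k => (B : ℝ) ^ (-1 / p k)) n * |a n| :=
      fun n => mul_nonneg (recover_weight_nonneg p hB n) (abs_nonneg _)
    refine ⟨B, hB, summable_of_sum_range_le (c := S) hnn fun N => ?_⟩
    refine (Finset.sum_le_sum_of_subset_of_nonneg
      (Finset.range_subset_range.2 N.le_succ) fun n _ _ => hnn n).trans ?_
    rw [sum_abs_mul_recover_weight]
    exact hS ⟨N, rfl⟩
  · rintro ⟨B, hB, h⟩
    refine mem_multiplier_c0F.2 fun y hy => ?_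
    obtain ⟨M, -, hM⟩ := exists_abs_le_weight hp hb hy hB
    refine Summable.of_nonneg_of_le (fun n => abs_nonneg _) (fun n => ?_) (h.mul_left M)
    rw [abs_mul, ← mul_assoc]
    exact mul_le_mul_of_nonneg_right (abs_recover_le hM n) (abs_nonneg _)

theorem alphaDual_cF {p : ℕ → ℝ} (hp : ∀ k, 0 < p k) :
    alphaDual (cF p) = alphaDual (c0F p) ∩ F2 := by
  ext a
  rw [alphaDual, mem_multiplier_cF hp fun u hu v hv => ell1_add_mul hu hv]
  refine and_congr_right fun _ => ?_
  simp only [ell1, F2, Set.mem_ofPred_eq, recover, mul_one, Finset.sum_mul]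

theorem betaDual_cF {p : ℕ → ℝ} (hp : ∀ k, 0 < p k) :
    betaDual (cF p) = betaDual (c0F p) ∩ F6 := by
  ext a
  rw [betaDual, mem_multiplier_cF hp fun u hu v hv => cs_add_mul hu hv]
  refine and_congr_right fun _ => ?_
  simp only [cs, F6, Set.mem_ofPred_eq, sum_recover_mul, mul_one, tri]
  exact exists_congr fun s => tendsto_iff_dist_tendsto_zero

theorem gammaDual_cF {p : ℕ → ℝ} (hp : ∀ k, 0 < p k) :
    gammaDual (cF p) = gammaDual (c0F p) ∩ F7 := by
  ext a
  rw [gammaDual, mem_multiplier_cF hp fun u hu v hv => bs_add_mul hu hv]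
  refine and_congr_right fun _ => ?_
  simp only [bs, F7, Set.mem_ofPred_eq, sum_recover_mul, mul_one, tri]

end FibSeq

theorem theorem2p9 (p : ℕ → ℝ) (hpos : ∀ k, 0 < p k) (hbdd : BddAbove (Set.range p)) :
    FibSeq.alphaDual (FibSeq.c0F p) = FibSeq.F1 p ∧
    FibSeq.alphaDual (FibSeq.cF p) = FibSeq.F1 p ∩ FibSeq.F2 ∧
    FibSeq.betaDual (FibSeq.c0F p) = FibSeq.F3 p ∩ FibSeq.F4 ∩ FibSeq.F5 p ∧
    FibSeq.betaDual (FibSeq.cF p) = FibSeq.betaDual (FibSeq.c0F p) ∩ FibSeq.F6 ∧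
    FibSeq.gammaDual (FibSeq.c0F p) = FibSeq.F3 p ∧
    FibSeq.gammaDual (FibSeq.cF p) = FibSeq.F3 p ∩ FibSeq.F7 := by
  have hα := FibSeq.alphaDual_c0F hpos hbdd
  have hγ := FibSeq.gammaDual_c0F hpos hbdd
  exact ⟨hα, hα ▸ FibSeq.alphaDual_cF hpos, FibSeq.betaDual_c0F hpos hbdd,
    FibSeq.betaDual_cF hpos, hγ, hγ ▸ FibSeq.gammaDual_cF hpos⟩
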